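/- Let $n \ge 2$, and let $d \ge 4$ be an even number. There exists a form (homogeneous polynomial) $f \in \mathbb{Q}[x_0,\dots,x_n]$ of degree $d$ with the following properties: (1) $f$ is irreducible over $\mathbb{Q}$, and decomposes into a product of $d$ linear forms over $\mathbb{C}$; (2) $f$ is a sum of two squares in $\mathbb{R}[x_0,\dots,x_n]$; (3) $f$ is not a sum of any number of squares in $\mathbb{Q}[x_0,\dots,x_n]$. For example, for $n = 2$ and $d = 4$, $$f = x_0^4 + x_0x_1^3 + x_1^4 - 3x_0^2x_1x_2 - 4x_0x_1^2x_2 + 2x_0^2x_2^2 + x_0x_2^3 + x_1x_2^3 + x_2^4$$ is such a form. -/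

import Mathlib

open MvPolynomial

/-- `g` decomposes into a product of `d` linear forms. -/
def IsProdOfLinearForms {σ R : Type*} [CommRing R] (d : ℕ) (g : MvPolynomial σ R) : Prop :=
  ∃ l : Fin d → MvPolynomial σ R, (∀ i, (l i).IsHomogeneous 1) ∧ g = ∏ i, l i

/-- `g` is a sum of two squares in the ring `R`. -/
def IsSumTwoSq {R : Type*} [CommRing R] (g : R) : Prop :=
  ∃ p q : R, g = p ^ 2 + q ^ 2

/-- The form `f ∈ ℚ[x_0, …, x_n]` of degree `d` is irreducible over `ℚ`, decomposes into linear
forms over `ℂ`, is a sum of two squares over `ℝ`, and is not a sum of any number of squares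
over `ℚ`. -/
structure IsSOSCounterexample (n d : ℕ) (f : MvPolynomial (Fin (n + 1)) ℚ) : Prop where
  isHomogeneous : f.IsHomogeneous d
  irreducible : Irreducible f
  splits : IsProdOfLinearForms d (map (algebraMap ℚ ℂ) f)
  sum_two_sq : IsSumTwoSq (map (algebraMap ℚ ℝ) f)
  not_sum_sq : ¬ IsSumSq f

/-- The explicit ternary quartic form. -/
noncomputable def exampleQuartic : MvPolynomial (Fin (2 + 1)) ℚ :=
  X 0 ^ 4 + X 0 * X 1 ^ 3 + X 1 ^ 4 - 3 * X 0 ^ 2 * X 1 * X 2 - 4 * X 0 * X 1 ^ 2 * X 2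
    + 2 * X 0 ^ 2 * X 2 ^ 2 + X 0 * X 2 ^ 3 + X 1 * X 2 ^ 3 + X 2 ^ 4

/-!
For a monic `g` over `ℚ` with roots `a`, take `f = ∏ (x₀ + a x₁ + a² x₂)`, the norm of a linear
form. If `g` has no real root, its roots come in conjugate pairs and each pair contributes to `f` a
factor `|p + i q|² = p² + q²`, so `f` is a sum of two squares over `ℝ`.

The lines of the roots `a ≠ b` meet in one point, which is real when `b` is the conjugate of `a`.
If `f = ∑ hᵢ²` over `ℚ`, every `hᵢ` vanishes at that real point. When the Galois group of `g` is
doubly transitive, `hᵢ` therefore vanishes at all the `deg g - 1` points of the line of `a` on the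
other lines; its degree is at most `deg g / 2`, so it vanishes on the whole line. Then `f` vanishes
on the line of `a` to order two, which is impossible since its linear factors are distinct.

Double transitivity holds when `g` has no rational root but factors over some `ℚ_p` as a linear
times an irreducible polynomial; by Hensel's lemma it suffices to see this factorization modulo `p`.
The example is the norm form of `X⁴ - X + 1`, with `p = 3`.
-/

open scoped Polynomial

section NormForm

variable {σ R S A : Type*} [CommRing R] [CommRing S] [CommRing A] [Algebra R A]

/-- The linear form `x₀ + a x₁ + a² x₂` in the coordinates picked out by `v`. -/
noncomputable def lineForm (v : Fin 3 ↪ σ) (a : R) : MvPolynomial σ R :=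
  X (v 0) + C a * X (v 1) + C (a ^ 2) * X (v 2)

theorem isHomogeneous_lineForm (v : Fin 3 ↪ σ) (a : R) : (lineForm v a).IsHomogeneous 1 :=
  ((isHomogeneous_X R _).add (isHomogeneous_C_mul_X a _)).add (isHomogeneous_C_mul_X (a ^ 2) _)

theorem isProdOfLinearForms_multiset_prod {s : Multiset (MvPolynomial σ R)}
    (hs : ∀ l ∈ s, l.IsHomogeneous 1) : IsProdOfLinearForms s.card s.prod := by
  rw [← s.length_toList, ← s.prod_toList]
  exact ⟨s.toList.get, fun i => hs _ (Multiset.mem_toList.1 (s.toList.get_mem i)),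
    by rw [← List.prod_ofFn, List.ofFn_get]⟩

theorem IsProdOfLinearForms.isHomogeneous {d : ℕ} {f : MvPolynomial σ R}
    (h : IsProdOfLinearForms d f) : f.IsHomogeneous d := by
  obtain ⟨l, hl, rfl⟩ := h
  simpa using IsHomogeneous.prod Finset.univ l (fun _ => 1) fun i _ => hl i

/-- The polynomial `a₀ + a₁ X + a₂ X²`, whose value at a root of `g` is a factor of the norm. -/
noncomputable def quadraticWithCoeffs (a : Fin 3 → A) : A[X] :=
  Polynomial.C (a 0) + Polynomial.C (a 1) * Polynomial.X + Polynomial.C (a 2) * Polynomial.X ^ 2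

/-- The product of `lineForm v a` over the roots `a` of the monic polynomial `g`, that is, the norm
of `x₀ + θ x₁ + θ² x₂` where `θ` is the class of `X` modulo `g`. It is encoded as a resultant with
respect to `θ`, so that its coefficients visibly lie in `R`. -/
noncomputable def normForm (v : Fin 3 ↪ σ) (g : R[X]) : MvPolynomial σ R :=
  (g.map C).resultant (quadraticWithCoeffs fun m => X (v m)) g.natDegree 2

theorem natDegree_quadraticWithCoeffs_le (a : Fin 3 → A) :
    (quadraticWithCoeffs a).natDegree ≤ 2 := by
  unfold quadraticWithCoeffs
  compute_degree

theorem aeval_normForm (v : Fin 3 ↪ σ) (g : R[X]) (u : σ → A) :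
    aeval u (normForm v g) = (g.map (algebraMap R A)).resultant
      (quadraticWithCoeffs fun m => u (v m)) g.natDegree 2 := by
  let φ : MvPolynomial σ R →+* A := (aeval u : MvPolynomial σ R →ₐ[R] A)
  have hC : φ.comp C = algebraMap R A := by ext; simp [φ]
  have hX : (quadraticWithCoeffs fun m => X (v m)).map φ =
      quadraticWithCoeffs fun m => u (v m) := by
    simp [quadraticWithCoeffs, φ]
  change φ (normForm v g) = _
  rw [normForm, ← Polynomial.resultant_map_map, Polynomial.map_map, hC, hX]

theorem map_normForm [Nontrivial S] (φ : R →+* S) (v : Fin 3 ↪ σ) {g : R[X]} (hg : g.Monic) :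
    map φ (normForm v g) = normForm v (g.map φ) := by
  have hC : (map φ).comp (C : R →+* MvPolynomial σ R) = C.comp φ := by ext; simp
  have hX : (quadraticWithCoeffs fun m => (X (v m) : MvPolynomial σ R)).map (map φ) =
      quadraticWithCoeffs fun m => X (v m) := by
    simp [quadraticWithCoeffs]
  rw [normForm, normForm, ← Polynomial.resultant_map_map, Polynomial.map_map, Polynomial.map_map,
    hC, hX, hg.natDegree_map]

theorem normForm_mul (v : Fin 3 ↪ σ) {g h : R[X]} (hg : g.Monic) (hh : h.Monic) :
    normForm v (g * h) = normForm v g * normForm v h := by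
  have hdeg (f : R[X]) : (f.map (C : R →+* MvPolynomial σ R)).natDegree = f.natDegree :=
    Polynomial.natDegree_map_eq_of_injective (C_injective σ R) f
  rw [normForm, hg.natDegree_mul hh, Polynomial.map_mul, ← hdeg g, ← hdeg h,
    Polynomial.resultant_mul_left _ _ _ _ (natDegree_quadraticWithCoeffs_le _), hdeg, hdeg]
  rfl

theorem normForm_X_sub_C (v : Fin 3 ↪ σ) (a : R) :
    normForm v (Polynomial.X - Polynomial.C a) = lineForm v a := by
  nontriviality R
  rw [normForm, Polynomial.natDegree_X_sub_C, Polynomial.map_sub, Polynomial.map_X,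
    Polynomial.map_C, Polynomial.resultant_X_sub_C_left _ _ _ (natDegree_quadraticWithCoeffs_le _)]
  simp only [quadraticWithCoeffs, lineForm, Polynomial.eval_add, Polynomial.eval_mul,
    Polynomial.eval_C, Polynomial.eval_X, Polynomial.eval_pow, C_pow]
  ring

theorem normForm_multiset_prod (v : Fin 3 ↪ σ) (s : Multiset R) :
    normForm v (s.map fun a => Polynomial.X - Polynomial.C a).prod =
      (s.map (lineForm v)).prod := by
  induction s using Multiset.induction_on with
  | empty => simp [normForm]
  | cons a s ih =>
    simp only [Multiset.map_cons, Multiset.prod_cons]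
    rw [normForm_mul v (Polynomial.monic_X_sub_C a)
      (Polynomial.monic_multiset_prod_of_monic _ _ fun b _ => Polynomial.monic_X_sub_C b), ih,
      normForm_X_sub_C]

theorem isProdOfLinearForms_normForm [IsDomain R] (v : Fin 3 ↪ σ) {g : R[X]} (hg : g.Monic)
    (hs : g.Splits) : IsProdOfLinearForms g.natDegree (normForm v g) := by
  rw [hs.natDegree_eq_card_roots, hs.eq_prod_roots_of_monic hg, normForm_multiset_prod,
    ← hs.eq_prod_roots_of_monic hg, ← Multiset.card_map (lineForm v)]
  refine isProdOfLinearForms_multiset_prod fun l hl => ?_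
  obtain ⟨a, -, rfl⟩ := Multiset.mem_map.1 hl
  exact isHomogeneous_lineForm v a

theorem isHomogeneous_normForm {K : Type*} [Field K] (v : Fin 3 ↪ σ) {g : K[X]} (hg : g.Monic) :
    (normForm v g).IsHomogeneous g.natDegree := by
  refine IsHomogeneous.of_map (algebraMap K (AlgebraicClosure K)).injective ?_
  rw [map_normForm _ v hg, ← Polynomial.natDegree_map (algebraMap K (AlgebraicClosure K))]
  exact (isProdOfLinearForms_normForm v (hg.map _) (IsAlgClosed.splits _)).isHomogeneous

end NormForm

section Viete

variable {σ R A : Type*} [CommRing R] [CommRing A] [Algebra R A]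

/-- The point of `A ^ σ` in which the lines `lineForm v x = 0` and `lineForm v y = 0` of the plane
with coordinates `v` meet; these coordinates are, up to sign, the elementary symmetric functions
of `x` and `y`. -/
noncomputable def vietePoint (v : Fin 3 ↪ σ) (x y : A) : σ → A :=
  Function.extend v ![x * y, -(x + y), 1] 0

theorem vietePoint_comm (v : Fin 3 ↪ σ) (x y : A) : vietePoint v x y = vietePoint v y x := by
  rw [vietePoint, vietePoint, mul_comm, add_comm]

theorem map_vietePoint {B F : Type*} [CommRing B] [FunLike F A B] [RingHomClass F A B] (φ : F)
    (v : Fin 3 ↪ σ) (x y : A) (i : σ) :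
    φ (vietePoint v x y i) = vietePoint v (φ x) (φ y) i := by
  rw [vietePoint, Function.apply_extend φ, vietePoint]
  congr 1
  · ext m; fin_cases m <;> simp
  · ext; simp

theorem map_aeval_vietePoint {B : Type*} [CommRing B] [Algebra R B] (φ : A →ₐ[R] B)
    (v : Fin 3 ↪ σ) (x y : A) (p : MvPolynomial σ R) :
    φ (aeval (vietePoint v x y) p) = aeval (vietePoint v (φ x) (φ y)) p := by
  rw [MvPolynomial.comp_aeval_apply]
  simp only [map_vietePoint]

theorem aeval_vietePoint_normForm (v : Fin 3 ↪ σ) (g : R[X]) (x y : A) :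
    aeval (vietePoint v x y) (normForm v g) = Polynomial.aeval x g * Polynomial.aeval y g := by
  nontriviality A
  have hquad : (quadraticWithCoeffs fun m => vietePoint v x y (v m)) =
      (Polynomial.X - Polynomial.C x) * (Polynomial.X - Polynomial.C y) := by
    simp only [vietePoint, v.injective.extend_apply, quadraticWithCoeffs, Matrix.cons_val,
      map_mul, map_neg, map_add, map_one]
    ring
  have hdeg : (g.map (algebraMap R A)).natDegree ≤ g.natDegree := Polynomial.natDegree_map_le
  have hmul := Polynomial.resultant_mul_right (g.map (algebraMap R A))
    (Polynomial.X - Polynomial.C x) (Polynomial.X - Polynomial.C y) _ hdeg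
  simp only [Polynomial.natDegree_X_sub_C, Polynomial.resultant_X_sub_C_right _ _ _ hdeg,
    Polynomial.eval_map_algebraMap] at hmul
  rw [aeval_normForm, hquad, hmul, mul_mul_mul_comm, ← mul_pow, neg_one_mul, neg_neg, one_pow,
    one_mul]

/-- The restriction of a polynomial in the coordinates `v` to the points `vietePoint v x y`, as a
polynomial in the indeterminate `y` over `R[x]`. -/
noncomputable def vietePullback (v : Fin 3 ↪ σ) : MvPolynomial σ R →ₐ[R] R[X][X] :=
  aeval (vietePoint v (Polynomial.C Polynomial.X) Polynomial.X)

theorem natDegree_aeval_vietePoint_C_X_le (v : Fin 3 ↪ σ) (a : A) (p : MvPolynomial σ R) :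
    (aeval (vietePoint v (Polynomial.C a) Polynomial.X) p).natDegree ≤
      (vietePullback v p).natDegree := by
  have hmap := map_aeval_vietePoint (Polynomial.mapAlgHom (Polynomial.aeval a)) v
    (Polynomial.C Polynomial.X) Polynomial.X p
  simp only [Polynomial.coe_mapAlgHom, Polynomial.map_C, Polynomial.map_X, RingHom.coe_coe,
    Polynomial.aeval_X] at hmap
  rw [← hmap]
  exact Polynomial.natDegree_map_le

theorem natDegree_vietePullback_normForm_le (v : Fin 3 ↪ σ) (g : R[X]) :
    (vietePullback v (normForm v g)).natDegree ≤ g.natDegree := by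
  rw [vietePullback, aeval_vietePoint_normForm, ← Polynomial.algebraMap_eq,
    Polynomial.aeval_algebraMap_apply, Polynomial.aeval_X_left_eq_map]
  exact (Polynomial.natDegree_C_mul_le _ _).trans Polynomial.natDegree_map_le

end Viete

section Irreducible

theorem irreducible_of_irreducible_aeval {σ R : Type*} [CommRing R] [IsDomain R] {u : σ → R[X]}
    (hu : ∀ i, (u i).natDegree ≤ 1) {p : MvPolynomial σ R}
    (hp : p.totalDegree ≤ (aeval u p).natDegree) (h : Irreducible (aeval u p)) :
    Irreducible p := by
  have hunit {q r : MvPolynomial σ R} (hqr : p = q * r) (hq : IsUnit (aeval u q)) : IsUnit q := by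
    have hp0 : p ≠ 0 := by rintro rfl; simp at h
    have hdeg : q.totalDegree = 0 := by
      have hmul := totalDegree_mul_of_isDomain (left_ne_zero_of_mul (hqr ▸ hp0))
        (right_ne_zero_of_mul (hqr ▸ hp0))
      have hr : (aeval u r).natDegree ≤ r.totalDegree := by
        simpa using! aeval_natDegree_le r le_rfl u hu
      have hpr : (aeval u p).natDegree ≤ (aeval u r).natDegree := by
        rw [hqr, map_mul]
        exact Polynomial.natDegree_mul_le.trans
          (by rw [Polynomial.natDegree_eq_zero_of_isUnit hq, zero_add])
      rw [hqr] at hp hpr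
      omega
    rw [totalDegree_eq_zero_iff_eq_C.1 hdeg, aeval_C, Polynomial.algebraMap_eq,
      Polynomial.isUnit_C] at hq
    rw [totalDegree_eq_zero_iff_eq_C.1 hdeg]
    exact hq.map C
  refine ⟨fun hp' => h.not_isUnit (hp'.map _), fun q r hqr => ?_⟩
  rw [hqr, map_mul] at h
  exact (h.isUnit_or_isUnit rfl).imp (hunit hqr) (hunit (hqr.trans (mul_comm q r)))

theorem natDegree_vietePoint_X_zero_le {σ R : Type*} [CommRing R] (v : Fin 3 ↪ σ) (i : σ) :
    (vietePoint v (Polynomial.X : R[X]) 0 i).natDegree ≤ 1 := by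
  by_cases hi : ∃ m, v m = i
  · obtain ⟨m, rfl⟩ := hi
    rw [vietePoint, v.injective.extend_apply]
    fin_cases m <;> simp [Polynomial.natDegree_X_le]
  · simp [vietePoint, Function.extend_apply' _ _ _ hi]

theorem aeval_vietePoint_X_zero_normForm {σ R : Type*} [CommRing R] (v : Fin 3 ↪ σ) (g : R[X]) :
    aeval (vietePoint v Polynomial.X 0) (normForm v g) = g * Polynomial.C (g.eval 0) := by
  rw [aeval_vietePoint_normForm, Polynomial.aeval_X_left_apply, ← Polynomial.C_0,
    ← Polynomial.algebraMap_eq, Polynomial.aeval_algebraMap_apply_eq_algebraMap_eval]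

theorem irreducible_normForm {σ K : Type*} [Field K] (v : Fin 3 ↪ σ) {g : K[X]} (hm : g.Monic)
    (hg : Irreducible g) (h0 : g.eval 0 ≠ 0) : Irreducible (normForm v g) := by
  refine irreducible_of_irreducible_aeval (natDegree_vietePoint_X_zero_le v) ?_ ?_
  · rw [aeval_vietePoint_X_zero_normForm, Polynomial.natDegree_mul_C h0]
    exact (isHomogeneous_normForm v hm).totalDegree_le
  · rw [aeval_vietePoint_X_zero_normForm]
    exact (irreducible_mul_isUnit (Polynomial.isUnit_C.2 h0.isUnit)).2 hg

end Irreducible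

section SumTwoSquares

variable {σ : Type*}

theorem IsSumTwoSq.mul {R : Type*} [CommRing R] {a b : R} (ha : IsSumTwoSq a)
    (hb : IsSumTwoSq b) : IsSumTwoSq (a * b) := by
  obtain ⟨x, y, rfl⟩ := ha
  obtain ⟨u, w, rfl⟩ := hb
  exact ⟨_, _, sq_add_sq_mul_sq_add_sq⟩

theorem exists_lineForm_eq_re_add_I_mul_im (v : Fin 3 ↪ σ) (z : ℂ) :
    ∃ p q : MvPolynomial σ ℝ,
      lineForm v z = map (algebraMap ℝ ℂ) p + C Complex.I * map (algebraMap ℝ ℂ) q ∧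
      lineForm v (starRingEnd ℂ z) =
        map (algebraMap ℝ ℂ) p - C Complex.I * map (algebraMap ℝ ℂ) q := by
  have hC (w : ℂ) : (C w : MvPolynomial σ ℂ) = C (w.re : ℂ) + C Complex.I * C (w.im : ℂ) := by
    rw [← C_mul, ← C_add, mul_comm, Complex.re_add_im]
  refine ⟨X (v 0) + C z.re * X (v 1) + C (z ^ 2).re * X (v 2),
    C z.im * X (v 1) + C (z ^ 2).im * X (v 2), ?_, ?_⟩
  · rw [lineForm, hC z, hC (z ^ 2)]
    simp only [map_add, map_mul, map_X, map_C, Complex.coe_algebraMap]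
    ring
  · rw [lineForm, ← map_pow, hC (starRingEnd ℂ z), hC (starRingEnd ℂ (z ^ 2))]
    simp only [map_add, map_mul, map_X, map_C, Complex.coe_algebraMap, Complex.conj_re,
      Complex.conj_im, Complex.ofReal_neg, C_neg]
    ring

theorem im_ne_zero_of_aeval_eq_zero {g : ℝ[X]} (hroot : ∀ x, ¬ g.IsRoot x) {z : ℂ}
    (hz : Polynomial.aeval z g = 0) : z.im ≠ 0 := fun him => by
  lift z to ℝ using him
  rw [← Complex.coe_algebraMap, Polynomial.aeval_algebraMap_apply_eq_algebraMap_eval] at hz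
  exact hroot z ((map_eq_zero _).1 hz)

theorem isSumTwoSq_normForm_of_conj_roots (v : Fin 3 ↪ σ) {q : ℝ[X]} (hm : q.Monic) {z : ℂ}
    (hq : q.map (algebraMap ℝ ℂ) =
      (Polynomial.X - Polynomial.C z) * (Polynomial.X - Polynomial.C (starRingEnd ℂ z))) :
    IsSumTwoSq (normForm v q) := by
  obtain ⟨a, b, hz, hconj⟩ := exists_lineForm_eq_re_add_I_mul_im v z
  refine ⟨a, b, map_injective _ (algebraMap ℝ ℂ).injective ?_⟩
  have hI : (C Complex.I : MvPolynomial σ ℂ) ^ 2 = -1 := by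
    rw [← C_pow, Complex.I_sq, C_neg, C_1]
  rw [map_normForm _ v hm, hq, normForm_mul v (Polynomial.monic_X_sub_C _)
    (Polynomial.monic_X_sub_C _), normForm_X_sub_C, normForm_X_sub_C, hz, hconj, map_add, map_pow,
    map_pow]
  linear_combination (-(map (algebraMap ℝ ℂ) b) ^ 2) * hI

theorem map_conj_quadratic (z : ℂ) :
    (Polynomial.X ^ 2 - Polynomial.C (2 * z.re) * Polynomial.X + Polynomial.C (‖z‖ ^ 2)).map
        (algebraMap ℝ ℂ) =
      (Polynomial.X - Polynomial.C z) * (Polynomial.X - Polynomial.C (starRingEnd ℂ z)) := by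
  have hadd := congrArg Polynomial.C (Complex.add_conj z)
  have hmul := congrArg Polynomial.C (Complex.mul_conj' z)
  simp only [Polynomial.C_add, Polynomial.C_mul] at hadd hmul
  simp only [Polynomial.map_add, Polynomial.map_sub, Polynomial.map_pow, Polynomial.map_mul,
    Polynomial.map_X, Polynomial.map_C, Complex.coe_algebraMap, Complex.ofReal_pow]
  linear_combination Polynomial.X * hadd - hmul

theorem isSumTwoSq_normForm (v : Fin 3 ↪ σ) {g : ℝ[X]} (hm : g.Monic)
    (hroot : ∀ x, ¬ g.IsRoot x) : IsSumTwoSq (normForm v g) := by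
  induction hd : g.natDegree using Nat.strong_induction_on generalizing g with
  | h d ih =>
    by_cases hd0 : g.natDegree = 0
    · exact ⟨1, 0, by simp [hm.natDegree_eq_zero.1 hd0, normForm]⟩
    obtain ⟨z, hz⟩ := IsAlgClosed.exists_aeval_eq_zero ℂ g
      (fun h => hd0 (Polynomial.natDegree_eq_of_degree_eq_some h))
    have him : z.im ≠ 0 := im_ne_zero_of_aeval_eq_zero hroot hz
    have hqm : (Polynomial.X ^ 2 - Polynomial.C (2 * z.re) * Polynomial.X +
        Polynomial.C (‖z‖ ^ 2)).Monic := by monicity!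
    have hqd : (Polynomial.X ^ 2 - Polynomial.C (2 * z.re) * Polynomial.X +
        Polynomial.C (‖z‖ ^ 2)).natDegree = 2 := by compute_degree!
    obtain ⟨h, rfl⟩ := g.quadratic_dvd_of_aeval_eq_zero_im_ne_zero hz him
    have hh : h.Monic := hqm.of_mul_monic_left hm
    rw [hqm.natDegree_mul hh] at hd
    rw [normForm_mul v hqm hh]
    exact (isSumTwoSq_normForm_of_conj_roots v hqm (map_conj_quadratic z)).mul
      (ih _ (by omega) hh (fun x hx => hroot x (hx.dvd (dvd_mul_left _ _))) rfl)

end SumTwoSquares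

section SumsOfSquares

theorem isSumSq_map {R S : Type*} [CommSemiring R] [CommSemiring S] (φ : R →+* S) {s : R}
    (hs : IsSumSq s) : IsSumSq (φ s) := by
  induction hs with
  | zero => rw [map_zero]; exact IsSumSq.zero
  | sq_add a _ ih => rw [map_add, map_mul]; exact IsSumSq.sq_add _ ih

theorem isFormallyReal_of_injective {R S : Type*} [CommRing R] [CommRing S] [IsFormallyReal S]
    {φ : R →+* S} (hφ : Function.Injective φ) : IsFormallyReal R :=
  .of_eq_zero_of_eq_zero_of_mul_self_add fun {s a} hs h => by
    have hsum : φ a * φ a + φ s = 0 := by rw [← map_mul, ← map_add, h, map_zero]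
    have hsq := IsFormallyReal.eq_zero_of_add_right (IsSumSq.mul_self _) (isSumSq_map φ hs) hsum
    exact (map_eq_zero_iff φ hφ).1 (IsReduced.eq_zero _ ⟨2, (sq _).trans hsq⟩)

variable {R : Type*} [CommRing R] [IsFormallyReal R] {p q : R[X]}

theorem degree_le_degree_add_and_isSumSq_leadingCoeff_add (hp : IsSumSq p.leadingCoeff)
    (hq : IsSumSq q.leadingCoeff) :
    p.degree ≤ (p + q).degree ∧ IsSumSq (p + q).leadingCoeff := by
  rcases lt_trichotomy p.degree q.degree with h | h | h
  · rw [Polynomial.degree_add_eq_right_of_degree_lt h, Polynomial.leadingCoeff_add_of_degree_lt h]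
    exact ⟨h.le, hq⟩
  · by_cases h0 : p.leadingCoeff + q.leadingCoeff = 0
    · have hp0 := Polynomial.leadingCoeff_eq_zero.1 (IsFormallyReal.eq_zero_of_add_right hp hq h0)
      rw [hp0, zero_add]
      exact ⟨by simp, hq⟩
    · rw [Polynomial.degree_add_eq_of_leadingCoeff_add_ne_zero h0,
        Polynomial.leadingCoeff_add_of_degree_eq h h0]
      exact ⟨le_max_left _ _, hp.add hq⟩
  · rw [Polynomial.degree_add_eq_left_of_degree_lt h, Polynomial.leadingCoeff_add_of_degree_lt' h]
    exact ⟨le_rfl, hp⟩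

variable [IsDomain R]

theorem isSumSq_leadingCoeff (hp : IsSumSq p) : IsSumSq p.leadingCoeff := by
  induction hp with
  | zero => simp
  | sq_add a _ ih =>
    refine (degree_le_degree_add_and_isSumSq_leadingCoeff_add ?_ ih).2
    rw [Polynomial.leadingCoeff_mul]
    exact IsSumSq.mul_self _

theorem degree_le_degree_add_of_isSumSq (hp : IsSumSq p) (hq : IsSumSq q) :
    p.degree ≤ (p + q).degree :=
  (degree_le_degree_add_and_isSumSq_leadingCoeff_add (isSumSq_leadingCoeff hp)
    (isSumSq_leadingCoeff hq)).1

instance isFormallyReal_polynomial : IsFormallyReal R[X] :=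
  .of_eq_zero_of_eq_zero_of_mul_self_add fun {s a} hs h => by
    have hdeg := degree_le_degree_add_of_isSumSq (IsSumSq.mul_self a) hs
    rw [h, Polynomial.degree_zero, le_bot_iff, Polynomial.degree_eq_bot] at hdeg
    exact mul_self_eq_zero.1 hdeg

theorem natDegree_le_natDegree_add_of_isSumSq (hp : IsSumSq p) (hq : IsSumSq q) :
    p.natDegree ≤ (p + q).natDegree :=
  Polynomial.natDegree_le_natDegree (degree_le_degree_add_of_isSumSq hp hq)

end SumsOfSquares

section DoublyTransitive

variable {K : Type*} [Field K]

/-- `g` is irreducible over `K` and, over the field `K(a)` generated by one of its roots `a`, the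
cofactor `g / (X - a)` is irreducible too. For separable `g` this says that the Galois group of
`g` is doubly transitive on the roots. -/
def IsDoublyTransitive (g : K[X]) : Prop :=
  Irreducible g ∧ ∃ h : (AdjoinRoot g)[X], Irreducible h ∧
    g.map (AdjoinRoot.of g) = (Polynomial.X - Polynomial.C (AdjoinRoot.root g)) * h

variable {σ : Type*} (v : Fin 3 ↪ σ)

theorem aeval_vietePoint_C_X_eq_zero {L M : Type*} [Field L] [Algebra K L] [Field M] [Algebra K M]
    [Algebra L M] [IsScalarTower K L M] {h : L[X]} (hh : Irreducible h) {a : L} {β : M}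
    (hβ : Polynomial.aeval β h = 0) {p : MvPolynomial σ K}
    (hp : (vietePullback v p).natDegree < h.natDegree)
    (h0 : aeval (vietePoint v (algebraMap L M a) β) p = 0) :
    aeval (vietePoint v (Polynomial.C a) Polynomial.X) p = 0 := by
  have hβp := map_aeval_vietePoint
    ((Polynomial.aeval β : L[X] →ₐ[L] M).restrictScalars K) v (Polynomial.C a) Polynomial.X p
  simp only [AlgHom.restrictScalars_apply, Polynomial.aeval_C, Polynomial.aeval_X, h0] at hβp
  exact Polynomial.eq_zero_of_dvd_of_natDegree_lt ((hh.dvd_iff_aeval_eq_zero hβ).1 hβp)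
    ((natDegree_aeval_vietePoint_C_X_le v a p).trans_lt hp)

theorem IsDoublyTransitive.dvd_aeval_vietePoint {M : Type*} [Field M] [Algebra K M] {g : K[X]}
    (hg : IsDoublyTransitive g) {p : MvPolynomial σ K}
    (hp : (vietePullback v p).natDegree + 1 < g.natDegree) {α β : M}
    (hα : Polynomial.aeval α g = 0) (hβ : Polynomial.aeval β g = 0) (hαβ : α ≠ β)
    (h0 : aeval (vietePoint v α β) p = 0) : g ∣ aeval (vietePoint v Polynomial.X 0) p := by
  obtain ⟨hirr, h, hh, hgh⟩ := hg
  have := Fact.mk hirr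
  have hdeg : g.natDegree = 1 + h.natDegree := by
    rw [← Polynomial.natDegree_map (AdjoinRoot.of g), hgh,
      Polynomial.natDegree_mul (Polynomial.X_sub_C_ne_zero _) hh.ne_zero,
      Polynomial.natDegree_X_sub_C]
  let φ : AdjoinRoot g →ₐ[K] M := AdjoinRoot.liftAlgHom g (Algebra.ofId K M) α hα
  let := φ.toRingHom.toAlgebra
  have : IsScalarTower K (AdjoinRoot g) M := .of_algebraMap_eq' φ.comp_algebraMap.symm
  have hroot : algebraMap (AdjoinRoot g) M (AdjoinRoot.root g) = α := AdjoinRoot.lift_root hα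
  have hβh : Polynomial.aeval β h = 0 := by
    have hβg := Polynomial.aeval_map_algebraMap (AdjoinRoot g) β g
    rw [AdjoinRoot.algebraMap_eq, hgh, hβ, map_mul, map_sub, Polynomial.aeval_X,
      Polynomial.aeval_C, hroot] at hβg
    exact (mul_eq_zero.1 hβg).resolve_left (sub_ne_zero.2 hαβ.symm)
  have hline := aeval_vietePoint_C_X_eq_zero v hh (a := AdjoinRoot.root g) hβh
    (p := p) (by omega) (by rwa [hroot])
  have heval := map_aeval_vietePoint
    ((Polynomial.aeval 0 : (AdjoinRoot g)[X] →ₐ[AdjoinRoot g] AdjoinRoot g).restrictScalars K) v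
    (Polynomial.C (AdjoinRoot.root g)) Polynomial.X p
  have hmk := map_aeval_vietePoint (AdjoinRoot.mkₐ g) v Polynomial.X 0 p
  rw [hline, map_zero] at heval
  simp only [AlgHom.restrictScalars_apply, Polynomial.aeval_C, Polynomial.aeval_X,
    Algebra.algebraMap_self_apply] at heval
  rw [AdjoinRoot.coe_mkₐ, AdjoinRoot.mk_X, map_zero, ← heval] at hmk
  exact AdjoinRoot.mk_eq_zero.1 hmk

end DoublyTransitive

section NotSumOfSquares

variable {σ K : Type*} [Field K] [Algebra K ℝ] (v : Fin 3 ↪ σ)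

theorem exists_ofReal_eq_vietePoint_conj (α : ℂ) :
    ∃ u : σ → ℝ, vietePoint v α (starRingEnd ℂ α) = algebraMap ℝ ℂ ∘ u := by
  have hreal (i : σ) : ∃ r : ℝ, vietePoint v α (starRingEnd ℂ α) i = r := by
    rw [← Complex.conj_eq_iff_real, map_vietePoint, Complex.conj_conj, vietePoint_comm]
  choose u hu using hreal
  exact ⟨u, funext hu⟩

theorem aeval_vietePoint_conj_eq_zero_of_isSumSq {p q : MvPolynomial σ K} (hp : IsSumSq p)
    (hq : IsSumSq q) {α : ℂ} (h0 : aeval (vietePoint v α (starRingEnd ℂ α)) (p + q) = 0) :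
    aeval (vietePoint v α (starRingEnd ℂ α)) p = 0 := by
  obtain ⟨u, hu⟩ := exists_ofReal_eq_vietePoint_conj v α
  have hreal (r : MvPolynomial σ K) :
      aeval (vietePoint v α (starRingEnd ℂ α)) r = algebraMap ℝ ℂ (aeval u r) := by
    rw [hu]
    exact aeval_algebraMap_apply ℂ u r
  have hnonneg {r : MvPolynomial σ K} (hr : IsSumSq r) : 0 ≤ aeval u r :=
    (isSumSq_map (aeval u : MvPolynomial σ K →ₐ[K] ℝ).toRingHom hr).nonneg
  rw [hreal, map_eq_zero, map_add] at h0
  rw [hreal, map_eq_zero]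
  exact ((add_eq_zero_iff_of_nonneg (hnonneg hp) (hnonneg hq)).1 h0).1

theorem IsDoublyTransitive.sq_dvd_aeval_vietePoint_of_isSumSq {g : K[X]}
    (hg : IsDoublyTransitive g) (h3 : 3 ≤ g.natDegree) {α : ℂ} (hα : Polynomial.aeval α g = 0)
    (him : α.im ≠ 0) {s : MvPolynomial σ K} (hs : IsSumSq s)
    (hdeg : (vietePullback v s).natDegree ≤ g.natDegree)
    (h0 : aeval (vietePoint v α (starRingEnd ℂ α)) s = 0) :
    g ^ 2 ∣ aeval (vietePoint v Polynomial.X 0) s := by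
  have : IsFormallyReal K := isFormallyReal_of_injective (algebraMap K ℝ).injective
  have hconj : Polynomial.aeval (starRingEnd ℂ α) g = 0 := by
    rw [← Polynomial.aeval_map_algebraMap ℝ, Polynomial.aeval_conj,
      Polynomial.aeval_map_algebraMap, hα, map_zero]
  induction hs with
  | zero => rw [map_zero]; exact dvd_zero _
  | @sq_add a t ht ih =>
    have ha : IsSumSq (a * a) := IsSumSq.mul_self a
    have hpull {p : MvPolynomial σ K} (hp : IsSumSq p) : IsSumSq (vietePullback v p) :=
      isSumSq_map (vietePullback v).toRingHom hp
    rw [map_add] at hdeg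
    have hdega := (natDegree_le_natDegree_add_of_isSumSq (hpull ha) (hpull ht)).trans hdeg
    have h0a := aeval_vietePoint_conj_eq_zero_of_isSumSq v ha ht h0
    rw [add_comm] at hdeg h0
    have hdegt := (natDegree_le_natDegree_add_of_isSumSq (hpull ht) (hpull ha)).trans hdeg
    have h0t := aeval_vietePoint_conj_eq_zero_of_isSumSq v ht ha h0
    rw [map_mul, ← sq, Polynomial.natDegree_pow] at hdega
    rw [map_mul, mul_self_eq_zero] at h0a
    have hdvd := hg.dvd_aeval_vietePoint v (by omega) hα hconj
      (fun h => him (Complex.conj_eq_iff_im.1 h.symm)) h0a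
    rw [map_add, map_mul, sq]
    exact dvd_add (mul_dvd_mul hdvd hdvd) (sq g ▸ ih hdegt h0t)

theorem IsDoublyTransitive.not_isSumSq_normForm {g : K[X]} (hg : IsDoublyTransitive g)
    (h3 : 3 ≤ g.natDegree) {α : ℂ} (hα : Polynomial.aeval α g = 0) (him : α.im ≠ 0) :
    ¬ IsSumSq (normForm v g) := fun hs => by
  have hdvd := hg.sq_dvd_aeval_vietePoint_of_isSumSq v h3 hα him hs
    (natDegree_vietePullback_normForm_le v g)
    (by rw [aeval_vietePoint_normForm, hα, zero_mul])
  have h0 : g.eval 0 ≠ 0 := hg.1.not_isRoot_of_natDegree_ne_one (by omega)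
  rw [aeval_vietePoint_X_zero_normForm, sq, mul_dvd_mul_iff_left hg.1.ne_zero] at hdvd
  exact hg.1.not_isUnit (isUnit_of_dvd_unit hdvd (Polynomial.isUnit_C.2 h0.isUnit))

theorem isSOSCounterexample_normForm {n : ℕ} (v : Fin 3 ↪ Fin (n + 1)) {g : ℚ[X]} (hm : g.Monic)
    (h3 : 3 ≤ g.natDegree) (hg : IsDoublyTransitive g)
    (hroot : ∀ x, ¬ (g.map (algebraMap ℚ ℝ)).IsRoot x) :
    IsSOSCounterexample n g.natDegree (normForm v g) where
  isHomogeneous := isHomogeneous_normForm v hm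
  irreducible := irreducible_normForm v hm hg.1
    (hg.1.not_isRoot_of_natDegree_ne_one (by omega))
  splits := by
    rw [map_normForm _ v hm, ← hm.natDegree_map (algebraMap ℚ ℂ)]
    exact isProdOfLinearForms_normForm v (hm.map _) (IsAlgClosed.splits _)
  sum_two_sq := by
    rw [map_normForm _ v hm]
    exact isSumTwoSq_normForm v (hm.map _) hroot
  not_sum_sq := by
    obtain ⟨α, hα⟩ := IsAlgClosed.exists_aeval_eq_zero ℂ g
      (Polynomial.degree_pos_of_irreducible hg.1).ne'
    refine hg.not_isSumSq_normForm v h3 hα (im_ne_zero_of_aeval_eq_zero hroot ?_)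
    rwa [Polynomial.aeval_map_algebraMap]

end NotSumOfSquares

section DoubleTransitivityCriteria

variable {K L : Type*} [Field K] [Field L] [Algebra K L] {g : K[X]} {a : L} {h : L[X]}

theorem irreducible_of_map_eq_X_sub_C_mul (hroot : ∀ x, ¬ g.IsRoot x) (hh : Irreducible h)
    (hgh : g.map (algebraMap K L) = (Polynomial.X - Polynomial.C a) * h) : Irreducible g := by
  have hprime : Prime (Polynomial.X - Polynomial.C a) := Polynomial.prime_X_sub_C a
  have hunit {p q : K[X]} (hpq : g = p * q)
      (hp : Polynomial.X - Polynomial.C a ∣ p.map (algebraMap K L)) : IsUnit q := by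
    obtain ⟨p', hp'⟩ := hp
    rw [hpq, Polynomial.map_mul, hp', mul_assoc, mul_right_inj' hprime.ne_zero] at hgh
    refine (hh.isUnit_or_isUnit hgh.symm).elim (fun hunit => ?_) (Polynomial.isUnit_map _).1
    have hdeg : p.degree = 1 := by
      rw [← Polynomial.degree_map p (algebraMap K L), hp', Polynomial.degree_mul,
        Polynomial.degree_X_sub_C, Polynomial.degree_eq_zero_of_isUnit hunit, add_zero]
    obtain ⟨x, hx⟩ := Polynomial.exists_root_of_degree_eq_one hdeg
    exact (hroot x (hpq ▸ hx.dvd (dvd_mul_right p q))).elim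
  refine ⟨fun hg => ?_, fun p q hpq => ?_⟩
  · exact hprime.not_isUnit
      (isUnit_of_mul_isUnit_left (hgh ▸ (Polynomial.isUnit_map (algebraMap K L)).2 hg))
  · rw [hpq, Polynomial.map_mul] at hgh
    rcases hprime.dvd_or_dvd (hgh ▸ dvd_mul_right _ h) with hp | hq
    · exact .inr (hunit hpq hp)
    · exact .inl (hunit (hpq.trans (mul_comm p q)) hq)

theorem isDoublyTransitive_of_map_eq_X_sub_C_mul (hroot : ∀ x, ¬ g.IsRoot x)
    (hh : Irreducible h)
    (hgh : g.map (algebraMap K L) = (Polynomial.X - Polynomial.C a) * h) :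
    IsDoublyTransitive g := by
  have hirr := irreducible_of_map_eq_X_sub_C_mul hroot hh hgh
  have := Fact.mk hirr
  have ha : Polynomial.aeval a g = 0 := by
    rw [← Polynomial.eval_map_algebraMap, hgh]
    simp
  let φ : AdjoinRoot g →ₐ[K] L := AdjoinRoot.liftAlgHom g (Algebra.ofId K L) a ha
  obtain ⟨q, hq⟩ := Polynomial.dvd_iff_isRoot.2 (AdjoinRoot.isRoot_root g)
  have hqh : q.map (φ : AdjoinRoot g →+* L) = h := by
    have hφ := congrArg (Polynomial.map (φ : AdjoinRoot g →+* L)) hq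
    rw [Polynomial.map_map, ← AdjoinRoot.algebraMap_eq, AlgHom.comp_algebraMap, hgh,
      Polynomial.map_mul, Polynomial.map_sub, Polynomial.map_X, Polynomial.map_C,
      RingHom.coe_coe, show φ (AdjoinRoot.root g) = a from AdjoinRoot.lift_root ha] at hφ
    exact (mul_left_cancel₀ (Polynomial.X_sub_C_ne_zero a) hφ).symm
  have : IsLocalHom (Polynomial.mapRingHom (φ : AdjoinRoot g →+* L)) :=
    ⟨fun _ => (Polynomial.isUnit_map _).1⟩
  refine ⟨hirr, q, .of_map (f := Polynomial.mapRingHom (φ : AdjoinRoot g →+* L)) ?_, hq⟩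
  rwa [Polynomial.coe_mapRingHom, hqh]

theorem exists_eq_X_sub_C_mul_of_henselianLocalRing.{u} {R k : Type u} [CommRing R] [IsDomain R]
    [HenselianLocalRing R] [Field k] {φ : R →+* k} (hφ : Function.Surjective φ) {G : R[X]}
    (hG : G.Monic) {b : k} {q : k[X]} (hq : Irreducible q) (hb : q.eval b ≠ 0)
    (hGq : G.map φ = (Polynomial.X - Polynomial.C b) * q) :
    ∃ (a : R) (h : R[X]), h.Monic ∧ Irreducible h ∧
      G = (Polynomial.X - Polynomial.C a) * h := by
  have hensel := ((HenselianLocalRing.TFAE R).out 0 2).1 ‹_›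
  obtain ⟨a, ha, rfl⟩ := hensel φ hφ G hG b
    (by rw [Polynomial.eval₂_eq_eval_map, hGq]; simp)
    (by rw [Polynomial.eval₂_eq_eval_map, ← Polynomial.derivative_map, hGq]; simpa using hb)
  obtain ⟨h, rfl⟩ := Polynomial.dvd_iff_isRoot.2 ha
  have hh : h.Monic := (Polynomial.monic_X_sub_C a).of_mul_monic_left hG
  refine ⟨a, h, hh, hh.irreducible_of_irreducible_map φ _ ?_, rfl⟩
  rw [Polynomial.map_mul, Polynomial.map_sub, Polynomial.map_X, Polynomial.map_C] at hGq
  rwa [mul_left_cancel₀ (Polynomial.X_sub_C_ne_zero _) hGq]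

instance henselianLocalRing_padicInt (p : ℕ) [Fact p.Prime] : HenselianLocalRing ℤ_[p] where
  is_henselian f hf a h0 hd :=
    HenselianRing.is_henselian (I := IsLocalRing.maximalIdeal ℤ_[p]) f hf a h0 (hd.map _)

theorem isDoublyTransitive_of_map_zmod_eq_X_sub_C_mul {p : ℕ} [Fact p.Prime] {G : ℤ[X]}
    (hG : G.Monic) (hroot : ∀ x, ¬ (G.map (Int.castRingHom ℚ)).IsRoot x) {b : ZMod p}
    {q : (ZMod p)[X]} (hq : Irreducible q) (hb : q.eval b ≠ 0)
    (hGq : G.map (Int.castRingHom (ZMod p)) = (Polynomial.X - Polynomial.C b) * q) :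
    IsDoublyTransitive (G.map (Int.castRingHom ℚ)) := by
  have hmod : (G.map (Int.castRingHom ℤ_[p])).map PadicInt.toZMod =
      (Polynomial.X - Polynomial.C b) * q := by
    rw [Polynomial.map_map, ← hGq]
    exact congrArg (G.map ·) (RingHom.ext_int _ _)
  obtain ⟨a, h, hm, hh, hGh⟩ := exists_eq_X_sub_C_mul_of_henselianLocalRing
    (ZMod.ringHom_surjective PadicInt.toZMod) (hG.map (Int.castRingHom ℤ_[p])) hq hb hmod
  refine isDoublyTransitive_of_map_eq_X_sub_C_mul hroot
    ((hm.irreducible_iff_irreducible_map_fraction_map (K := ℚ_[p])).1 hh)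
    (a := algebraMap ℤ_[p] ℚ_[p] a) ?_
  have hmap := congrArg (Polynomial.map (algebraMap ℤ_[p] ℚ_[p])) hGh
  rw [Polynomial.map_mul, Polynomial.map_sub, Polynomial.map_X, Polynomial.map_C] at hmap
  rw [← hmap, Polynomial.map_map, Polynomial.map_map]
  exact congrArg (G.map ·) (RingHom.ext_int _ _)

end DoubleTransitivityCriteria

section Existence

open Filter

open IntermediateField in
theorem exists_monic_irreducible_natDegree_eq (p : ℕ) [Fact p.Prime] {n : ℕ} (hn : n ≠ 0) :
    ∃ q : (ZMod p)[X], q.Monic ∧ Irreducible q ∧ q.natDegree = n := by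
  obtain ⟨α, hα⟩ := Field.exists_primitive_element_of_finite_bot (ZMod p) (GaloisField p n)
  have hint : IsIntegral (ZMod p) α := Algebra.IsIntegral.isIntegral α
  refine ⟨minpoly (ZMod p) α, minpoly.monic hint, minpoly.irreducible hint, ?_⟩
  rw [← adjoin.finrank hint, hα, finrank_top', GaloisField.finrank p hn]

theorem exists_forall_le_eval_of_even_natDegree {g : ℝ[X]} (hm : g.Monic)
    (heven : Even g.natDegree) : ∃ c, ∀ x, c ≤ g.eval x := by
  rcases Nat.eq_zero_or_pos g.natDegree with h0 | hpos
  · exact ⟨1, fun x => by rw [hm.natDegree_eq_zero.1 h0, Polynomial.eval_one]⟩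
  have htop {f : ℝ[X]} (hf : f.Monic) (hpos : 0 < f.natDegree) :
      Tendsto (fun x => f.eval x) atTop atTop :=
    f.tendsto_atTop_of_leadingCoeff_nonneg (Polynomial.natDegree_pos_iff_degree_pos.1 hpos)
      (hf.leadingCoeff ▸ zero_le_one)
  have hbot : Tendsto (fun x => g.eval x) atBot atTop := by
    have hneg : (g.comp (-Polynomial.X)).Monic := by
      simpa [heven.neg_one_pow] using hm.neg_one_pow_natDegree_mul_comp_neg_X
    have hdeg : (g.comp (-Polynomial.X)).natDegree = g.natDegree := by
      rw [Polynomial.natDegree_comp, Polynomial.natDegree_neg, Polynomial.natDegree_X, mul_one]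
    simpa [Function.comp_def] using (htop hneg (hdeg ▸ hpos)).comp tendsto_neg_atBot_atTop
  obtain ⟨x, hx⟩ := g.continuous.exists_forall_le
    (cocompact_eq_atBot_atTop (α := ℝ) ▸ hbot.sup (htop hm hpos))
  exact ⟨_, hx⟩

theorem exists_monic_map_eq_and_not_isRoot {p : ℕ} [Fact p.Prime] {q : (ZMod p)[X]}
    (hm : q.Monic) (heven : Even q.natDegree) :
    ∃ G : ℤ[X], G.Monic ∧ G.map (Int.castRingHom (ZMod p)) = q ∧
      ∀ x, ¬ (G.map (Int.castRingHom ℝ)).IsRoot x := by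
  rcases Nat.eq_zero_or_pos q.natDegree with h0 | hpos
  · exact ⟨1, Polynomial.monic_one, by rw [hm.natDegree_eq_zero.1 h0, Polynomial.map_one],
      by simp⟩
  obtain ⟨G, hGq, hGd, hG⟩ := Polynomial.lifts_and_natDegree_eq_and_monic
    (Polynomial.mem_lifts_of_surjective (ZMod.ringHom_surjective (Int.castRingHom (ZMod p))) q) hm
  obtain ⟨c, hc⟩ := exists_forall_le_eval_of_even_natDegree (hG.map (Int.castRingHom ℝ))
    (by rwa [hG.natDegree_map, hGd])
  obtain ⟨N, hN⟩ := exists_lt_nsmul (Nat.cast_pos.2 (Fact.out : p.Prime).pos) (-c)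
  refine ⟨G + Polynomial.C (N * p : ℤ), hG.add_of_left ?_, by simp [hGq], fun x hx => ?_⟩
  · exact Polynomial.degree_C_le.trans_lt (Polynomial.natDegree_pos_iff_degree_pos.1 (hGd ▸ hpos))
  · have hGx : (G.map (Int.castRingHom ℝ)).eval x + N * p = 0 := by simpa using hx
    rw [nsmul_eq_mul] at hN
    linarith [hc x]

theorem isSOSCounterexample_normForm_of_map_zmod {n : ℕ} (v : Fin 3 ↪ Fin (n + 1)) {p : ℕ}
    [Fact p.Prime] {G : ℤ[X]} (hG : G.Monic) (h3 : 3 ≤ G.natDegree)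
    (hroot : ∀ x, ¬ (G.map (Int.castRingHom ℝ)).IsRoot x) {b : ZMod p} {q : (ZMod p)[X]}
    (hq : Irreducible q) (hb : q.eval b ≠ 0)
    (hGq : G.map (Int.castRingHom (ZMod p)) = (Polynomial.X - Polynomial.C b) * q) :
    IsSOSCounterexample n G.natDegree (normForm v (G.map (Int.castRingHom ℚ))) := by
  have hmap : (G.map (Int.castRingHom ℚ)).map (algebraMap ℚ ℝ) = G.map (Int.castRingHom ℝ) := by
    rw [Polynomial.map_map]
    exact congrArg (G.map ·) (RingHom.ext_int _ _)
  rw [← hmap] at hroot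
  rw [← hG.natDegree_map (Int.castRingHom ℚ)] at h3 ⊢
  exact isSOSCounterexample_normForm v (hG.map _) h3
    (isDoublyTransitive_of_map_zmod_eq_X_sub_C_mul hG
      (fun x hx => hroot _ (hx.map (f := algebraMap ℚ ℝ))) hq hb hGq) hroot

theorem exists_isSOSCounterexample {n d : ℕ} (hn : 2 ≤ n) (hd : 4 ≤ d) (heven : Even d) :
    ∃ f : MvPolynomial (Fin (n + 1)) ℚ, IsSOSCounterexample n d f := by
  obtain ⟨q, hqm, hq, hqd⟩ := exists_monic_irreducible_natDegree_eq 2 (n := d - 1) (by omega)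
  have hXq := (Polynomial.monic_X_sub_C (0 : ZMod 2)).mul hqm
  have hXqd : ((Polynomial.X - Polynomial.C 0) * q).natDegree = d := by
    rw [(Polynomial.monic_X_sub_C _).natDegree_mul hqm, Polynomial.natDegree_X_sub_C, hqd]
    omega
  obtain ⟨G, hG, hGq, hroot⟩ := exists_monic_map_eq_and_not_isRoot hXq (hXqd ▸ heven)
  have hGd : G.natDegree = d := by rw [← hG.natDegree_map (Int.castRingHom (ZMod 2)), hGq, hXqd]
  refine ⟨_, hGd ▸ isSOSCounterexample_normForm_of_map_zmod
    (Fin.castLEEmb (Nat.succ_le_succ hn)) hG (by omega) hroot hq ?_ hGq⟩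
  exact hq.not_isRoot_of_natDegree_ne_one (by omega)

end Existence

section Example

theorem resultant_X_pow_four_sub_X_add_one_quadratic {A : Type*} [CommRing A] (a : Fin 3 → A) :
    (Polynomial.X ^ 4 - Polynomial.X + 1 : A[X]).resultant (quadraticWithCoeffs a) 4 2 =
      a 0 ^ 4 + a 0 * a 1 ^ 3 + a 1 ^ 4 - 3 * a 0 ^ 2 * a 1 * a 2 - 4 * a 0 * a 1 ^ 2 * a 2
        + 2 * a 0 ^ 2 * a 2 ^ 2 + a 0 * a 2 ^ 3 + a 1 * a 2 ^ 3 + a 2 ^ 4 := by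
  have hsylv : (Polynomial.X ^ 4 - Polynomial.X + 1 : A[X]).sylvester
      (quadraticWithCoeffs a) 4 2 =
      !![a 0, 0, 0, 0, 1, 0;
         a 1, a 0, 0, 0, -1, 1;
         a 2, a 1, a 0, 0, 0, -1;
         0, a 2, a 1, a 0, 0, 0;
         0, 0, a 2, a 1, 1, 0;
         0, 0, 0, a 2, 0, 1] := by
    ext i j
    fin_cases i <;> fin_cases j <;>
      simp [Polynomial.sylvester, quadraticWithCoeffs, Fin.addCases, Polynomial.coeff_X,
        Polynomial.coeff_one, Polynomial.coeff_C]
  rw [Polynomial.resultant, hsylv]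
  simp [Matrix.det_succ_row_zero, Fin.sum_univ_succ, Fin.succAbove]
  ring

theorem normForm_X_pow_four_sub_X_add_one :
    normForm (Function.Embedding.refl (Fin 3)) (Polynomial.X ^ 4 - Polynomial.X + 1 : ℚ[X]) =
      exampleQuartic := by
  have hdeg : (Polynomial.X ^ 4 - Polynomial.X + 1 : ℚ[X]).natDegree = 4 := by compute_degree!
  have hmap : (Polynomial.X ^ 4 - Polynomial.X + 1 : ℚ[X]).map
      (C : ℚ →+* MvPolynomial (Fin 3) ℚ) = Polynomial.X ^ 4 - Polynomial.X + 1 := by simp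
  rw [normForm, hdeg, hmap]
  exact resultant_X_pow_four_sub_X_add_one_quadratic X

theorem irreducible_X_pow_three_sub_X_sq_add_X_add_one :
    Irreducible (Polynomial.X ^ 3 - Polynomial.X ^ 2 + Polynomial.X + 1 : (ZMod 3)[X]) := by
  have hdeg : (Polynomial.X ^ 3 - Polynomial.X ^ 2 + Polynomial.X + 1 :
      (ZMod 3)[X]).natDegree = 3 := by compute_degree!
  rw [Polynomial.irreducible_iff_roots_eq_zero_of_degree_le_three (by omega) (by omega)]
  refine Multiset.eq_zero_of_forall_notMem fun x hx => ?_
  have hx' := Polynomial.isRoot_of_mem_roots hx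
  simp only [Polynomial.IsRoot, Polynomial.eval_add, Polynomial.eval_sub, Polynomial.eval_pow,
    Polynomial.eval_X, Polynomial.eval_one] at hx'
  clear hx
  revert x
  decide

theorem isSOSCounterexample_exampleQuartic : IsSOSCounterexample 2 4 exampleQuartic := by
  have hdeg : (Polynomial.X ^ 4 - Polynomial.X + 1 : ℤ[X]).natDegree = 4 := by compute_degree!
  have hmonic : (Polynomial.X ^ 4 - Polynomial.X + 1 : ℤ[X]).Monic := by monicity!
  have hroot (x : ℝ) : ¬ ((Polynomial.X ^ 4 - Polynomial.X + 1 : ℤ[X]).map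
      (Int.castRingHom ℝ)).IsRoot x := by
    have hpos : 0 < x ^ 4 - x + 1 := by nlinarith [sq_nonneg (x ^ 2 - 1 / 2), sq_nonneg (x - 1 / 2)]
    simpa using hpos.ne'
  have hfactor : (Polynomial.X ^ 4 - Polynomial.X + 1 : ℤ[X]).map (Int.castRingHom (ZMod 3)) =
      (Polynomial.X - Polynomial.C (-1)) *
        (Polynomial.X ^ 3 - Polynomial.X ^ 2 + Polynomial.X + 1) := by
    have h3 : (3 : (ZMod 3)[X]) = 0 := CharP.cast_eq_zero (ZMod 3)[X] 3
    simp only [Polynomial.map_add, Polynomial.map_sub, Polynomial.map_pow, Polynomial.map_X,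
      Polynomial.map_one, Polynomial.C_neg, Polynomial.C_1]
    linear_combination (-Polynomial.X) * h3
  have hneg : (Polynomial.X ^ 3 - Polynomial.X ^ 2 + Polynomial.X + 1 :
      (ZMod 3)[X]).eval (-1) ≠ 0 := by
    simp only [Polynomial.eval_add, Polynomial.eval_sub, Polynomial.eval_pow, Polynomial.eval_X,
      Polynomial.eval_one]
    decide
  have h := isSOSCounterexample_normForm_of_map_zmod (.refl (Fin 3)) hmonic (by omega) hroot
    irreducible_X_pow_three_sub_X_sq_add_X_add_one hneg hfactor
  simpa [hdeg, normForm_X_pow_four_sub_X_add_one] using h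

end Example

theorem theorem2p1 :
    (∀ n d : ℕ, 2 ≤ n → 4 ≤ d → Even d →
      ∃ f : MvPolynomial (Fin (n + 1)) ℚ, IsSOSCounterexample n d f) ∧
    IsSOSCounterexample 2 4 exampleQuartic :=
  ⟨fun _ _ => exists_isSOSCounterexample, isSOSCounterexample_exampleQuartic⟩
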